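/- Let $(\mathcal W,\|\cdot\|)$ be a real separable Banach space with Borel $\sigma$-algebra $\mathcal B$, and let $\mathbb P$ be a centred Gaussian measure on $\mathcal W$, i.e. there is a symmetric bilinear form $q$ on $\mathcal W^*$ with $\int_{\mathcal W} e^{i\varphi(\omega)}\,d\mathbb P(\omega)=e^{-\frac12 q(\varphi,\varphi)}$ for all $\varphi\in\mathcal W^*$. For $f\in L^2(\mathbb P)$ put $Jf:=\int_{\mathcal W}\omega f(\omega)\,d\mathbb P(\omega)\in\mathcal W$, and let $\mathcal H:=J\big(\overline{\mathcal W^*}^{L^2(\mathbb P)}\big)\subset\mathcal W$ be the Cameron–Martin space, a Hilbert space under $\langle Jf,Jg\rangle_{\mathcal H}:=\langle f,g\rangle_{L^2(\mathbb P)}$ for $f,g\in\overline{\mathcal W^*}^{L^2(\mathbb P)}$. Let $\Phi:\mathcal W\times\mathcal W\to\mathbb R$ be a bounded non-negative quadratic form, i.e. a bounded symmetric bilinear form with $\Phi(\omega,\omega)\ge 0$ for all $\omega\in\mathcal W$. Then there is a unique bounded linear operator $\hat\Phi:\mathcal H\to\mathcal H$ such that $$\Phi(h,k)=\langle\hat\Phi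 h,k\rangle_{\mathcal H}\qquad\text{for all } h,k\in\mathcal H,$$ and $\hat\Phi$ is trace-class. If, in addition, $\hat\Phi$ is not of finite rank, then $\Phi^{-1}\in L^{\infty-}(\mathcal W,\mathbb P):=\bigcap_{1\le p<\infty}L^p(\mathcal W,\mathbb P)$, that is, $\Phi(\omega,\omega)>0$ for $\mathbb P$-almost every $\omega$, and the function $\omega\mapsto\Phi(\omega,\omega)^{-1}$ belongs to $L^p(\mathcal W,\mathbb P)$ for every $1\le p<\infty$. -/

import Mathlib

open MeasureTheory ProbabilityTheory
open scoped ENNReal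

/-!
The Cameron–Martin space of a Gaussian measure on a separable Banach space, and trace-class
operators on a real Hilbert space.
-/

namespace CameronMartin

noncomputable section

universe u

/-- The closure in `L²(P)` of the (classes of the) continuous linear functionals on `W`.
`StrongDual.toLp P 2 φ` is the class of `φ`, since a Gaussian measure has finite moments. -/
def dualClosure {W : Type u} [NormedAddCommGroup W] [NormedSpace ℝ W]
    [MeasurableSpace W] [BorelSpace W] (P : Measure W) : Submodule ℝ (Lp ℝ 2 P) :=
  (LinearMap.range (StrongDual.toLp (𝕜 := ℝ) P 2).toLinearMap).topologicalClosure

theorem integrable_smul_id {W : Type u} [NormedAddCommGroup W] [NormedSpace ℝ W] [CompleteSpace W]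
    [SecondCountableTopology W] [MeasurableSpace W] [BorelSpace W]
    (P : Measure W) [IsGaussian P] (f : Lp ℝ 2 P) : Integrable (fun ω => f ω • ω) P := by
  have h : MemLp (fun ω => f ω • id ω) 1 P :=
    MemLp.smul (p := 2) (q := 2) (IsGaussian.memLp_id P 2 (by simp)) (Lp.memLp f)
  exact memLp_one_iff_integrable.mp h

/-- The map `J : L²(P) → W`, `J f = ∫ ω f(ω) dP(ω)` (a Bochner integral). -/
def J {W : Type u} [NormedAddCommGroup W] [NormedSpace ℝ W] [CompleteSpace W]
    [SecondCountableTopology W] [MeasurableSpace W] [BorelSpace W]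
    (P : Measure W) [IsGaussian P] : Lp ℝ 2 P →ₗ[ℝ] W where
  toFun f := ∫ ω, f ω • ω ∂P
  map_add' f g := by
    rw [← integral_add (integrable_smul_id P f) (integrable_smul_id P g)]
    refine integral_congr_ae ?_
    filter_upwards [Lp.coeFn_add f g] with ω hω
    rw [hω, Pi.add_apply, add_smul]
  map_smul' c f := by
    rw [RingHom.id_apply, ← integral_smul]
    refine integral_congr_ae ?_
    filter_upwards [Lp.coeFn_smul c f] with ω hω
    rw [hω, Pi.smul_apply, smul_assoc]

theorem apply_J {W : Type u} [NormedAddCommGroup W] [NormedSpace ℝ W] [CompleteSpace W]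
    [SecondCountableTopology W] [MeasurableSpace W] [BorelSpace W]
    (P : Measure W) [IsGaussian P] (f : Lp ℝ 2 P) (φ : StrongDual ℝ W) :
    φ (J P f) = inner ℝ (StrongDual.toLp P 2 φ) f := by
  have h2 : MemLp id 2 P := IsGaussian.memLp_id P 2 (by simp)
  change φ (∫ ω, f ω • ω ∂P) = _
  rw [← ContinuousLinearMap.integral_comp_comm φ (integrable_smul_id P f), L2.inner_def,
    StrongDual.toLp_apply h2]
  refine integral_congr_ae ?_
  filter_upwards [MemLp.coeFn_toLp (h2.continuousLinearMap_comp φ)] with ω hω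
  have hω' : (MemLp.toLp φ (h2.continuousLinearMap_comp φ) : W → ℝ) ω = φ ω := hω
  rw [map_smul, hω']
  simp

theorem injective_J {W : Type u} [NormedAddCommGroup W] [NormedSpace ℝ W] [CompleteSpace W]
    [SecondCountableTopology W] [MeasurableSpace W] [BorelSpace W]
    (P : Measure W) [IsGaussian P] :
    Function.Injective ((J P).domRestrict (dualClosure P)) := by
  rw [injective_iff_map_eq_zero]
  rintro ⟨f, hf⟩ h0
  have h0' : J P f = 0 := h0
  have horth : f ∈ (LinearMap.range (StrongDual.toLp (𝕜 := ℝ) P 2).toLinearMap)ᗮ := by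
    rw [Submodule.mem_orthogonal]
    rintro _ ⟨φ, rfl⟩
    have := apply_J P f φ
    rw [h0', map_zero] at this
    exact this.symm
  rw [← Submodule.orthogonal_closure] at horth
  have : inner ℝ f f = 0 := (Submodule.mem_orthogonal _ _).mp horth f hf
  exact Subtype.ext (inner_self_eq_zero.mp this)

/-- The Cameron–Martin space `H` as a subspace of `W`: the image under `J` of the `L²(P)`-closure
of the dual. -/
def subspace {W : Type u} [NormedAddCommGroup W] [NormedSpace ℝ W] [CompleteSpace W]
    [SecondCountableTopology W] [MeasurableSpace W] [BorelSpace W]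
    (P : Measure W) [IsGaussian P] : Submodule ℝ W :=
  LinearMap.range ((J P).domRestrict (dualClosure P))

/-- The Cameron–Martin space `H` as a type of its own: its elements are those of `subspace P`, but
it carries the Cameron–Martin inner product below and not the norm of `W`. -/
def Space {W : Type u} [NormedAddCommGroup W] [NormedSpace ℝ W] [CompleteSpace W]
    [SecondCountableTopology W] [MeasurableSpace W] [BorelSpace W]
    (P : Measure W) [IsGaussian P] : Type u := subspace P

section Instances

variable {W : Type u} [NormedAddCommGroup W] [NormedSpace ℝ W] [CompleteSpace W]
  [SecondCountableTopology W] [MeasurableSpace W] [BorelSpace W] (P : Measure W) [IsGaussian P]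

instance : AddCommGroup (Space P) := inferInstanceAs (AddCommGroup (subspace P))

instance : Module ℝ (Space P) := inferInstanceAs (Module ℝ (subspace P))

/-- The inclusion `H → W`. -/
def incl : Space P →ₗ[ℝ] W := (subspace P).subtype

/-- `J` as a linear bijection from the closure of the dual onto `H`. -/
def equiv : dualClosure P ≃ₗ[ℝ] Space P :=
  LinearEquiv.ofInjective ((J P).domRestrict (dualClosure P)) (injective_J P)

theorem incl_equiv (f : dualClosure P) : incl P (equiv P f) = ∫ ω, (f : Lp ℝ 2 P) ω • ω ∂P := rfl

instance : NormedAddCommGroup (Space P) :=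
  NormedAddCommGroup.induced (Space P) (dualClosure P) (equiv P).symm (equiv P).symm.injective

/-- The inner product of `H` is the one with `⟪J f, J g⟫ = ⟪f, g⟫` (inner product of `L²(P)`). -/
instance : InnerProductSpace ℝ (Space P) :=
  InnerProductSpace.induced (equiv P).symm

theorem inner_equiv (f g : dualClosure P) :
    inner ℝ (equiv P f) (equiv P g) = inner ℝ (f : Lp ℝ 2 P) (g : Lp ℝ 2 P) := by
  change inner ℝ ((equiv P).symm (equiv P f)) ((equiv P).symm (equiv P g)) = _
  simp

theorem norm_equiv_symm (h : Space P) : ‖(equiv P).symm h‖ = ‖h‖ := rfl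

/-- The Cameron–Martin space is isometric to a closed subspace of `L²(P)`, hence complete. -/
instance : CompleteSpace (Space P) := by
  have : CompleteSpace (dualClosure P) :=
    (Submodule.isClosed_topologicalClosure _).completeSpace_coe
  let e : Space P ≃ₗᵢ[ℝ] dualClosure P := ⟨(equiv P).symm, norm_equiv_symm P⟩
  exact (completeSpace_congr (e := e.toEquiv) e.isometry.isUniformEmbedding).mpr this

end Instances

/-- A bounded operator `T` on a real Hilbert space is trace-class if its absolute value `S = |T|`,
the positive operator with `S² = T* T`, has a finite trace `∑ ⟪S bᵢ, bᵢ⟫` in every orthonormal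
basis `b`. -/
def IsTraceClass {H : Type u} [NormedAddCommGroup H] [InnerProductSpace ℝ H] [CompleteSpace H]
    (T : H →L[ℝ] H) : Prop :=
  ∃ S : H →L[ℝ] H, S.IsPositive ∧ S ∘L S = ContinuousLinearMap.adjoint T ∘L T ∧
    ∀ (ι : Type u) (b : HilbertBasis ι ℝ H), Summable fun i => inner ℝ (S (b i)) (b i)

/-- `T` is the operator on the Cameron–Martin space induced by the bilinear form `Φ` on `W`. -/
def IsInducedOperator {W : Type u} [NormedAddCommGroup W] [NormedSpace ℝ W] [CompleteSpace W]
    [SecondCountableTopology W] [MeasurableSpace W] [BorelSpace W]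
    (P : Measure W) [IsGaussian P] (Φ : W →L[ℝ] W →L[ℝ] ℝ) (T : Space P →L[ℝ] Space P) : Prop :=
  ∀ h k : Space P, Φ (incl P h) (incl P k) = inner ℝ (T h) k

end

end CameronMartin

/-! The induced operator `T` comes from Riesz representation, since `H` embeds continuously in `W`.
It is positive, so `|T| = T`, and a Bessel-type inequality (`sum_apply_incl_le_integral`) bounds its
trace by `∫ Φ(ω, ω) dP`.

For the negative moments, `Φ(h, ·)` and `Φ(k, ·)` have covariance `⟪T h, T k⟫`. If the range of `T`
is infinite-dimensional, it contains orthonormal `T hᵢ`, `i < 4m`, so the `Xᵢ = Φ(hᵢ, ·)` are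
independent standard Gaussians. Cauchy–Schwarz gives `Xᵢ² ≤ cᵢ Φ(ω, ω)` with `cᵢ = Φ(hᵢ, hᵢ)`. Hence
`Φ(ω, ω)⁻ᵐ ≤ ∏ cᵢ^(1/4) |Xᵢ|^(-1/2)` almost surely, with finite expectation by independence. No
spectral decomposition is needed. -/

/-! ### Negative moments from independent Gaussian lower bounds -/

theorem lintegral_abs_rpow_gaussianReal_lt_top {r : ℝ} (hr : -1 < r) (hr0 : r ≤ 0) :
    ∫⁻ x, ENNReal.ofReal (|x| ^ r) ∂(gaussianReal 0 1) < ∞ := by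
  have hm : MeasurableSet (Set.Ioc (-1 : ℝ) 1) := measurableSet_Ioc
  rw [← lintegral_add_compl _ hm]
  refine ENNReal.add_lt_top.mpr ⟨?_, ?_⟩
  -- The Gaussian density is at most `1`, so near the origin Lebesgue measure can replace it.
  · have hle : gaussianReal 0 1 ≤ volume := by
      rw [gaussianReal_of_var_ne_zero 0 one_ne_zero]
      refine Measure.le_intro fun s hs _ => ?_
      rw [withDensity_apply _ hs, ← setLIntegral_one s]
      refine lintegral_mono fun x => ?_
      rw [gaussianPDF_def]
      refine ENNReal.ofReal_le_one.mpr ?_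
      rw [gaussianPDFReal]
      refine mul_le_one₀ (inv_le_one_of_one_le₀ ?_) (Real.exp_nonneg _) ?_
      · rw [Real.one_le_sqrt]
        have := Real.pi_gt_three
        norm_num
        linarith
      · rw [Real.exp_le_one_iff, neg_div]
        exact neg_nonpos.mpr (by positivity)
    refine (lintegral_mono' (Measure.restrict_mono le_rfl hle) le_rfl).trans_lt ?_
    have hint : IntervalIntegrable (fun x : ℝ => (x : ℂ) ^ (r : ℂ)) volume (-1) 1 :=
      intervalIntegral.intervalIntegrable_cpow' (by simpa using hr)
    have h := ((intervalIntegrable_iff_integrableOn_Ioc_of_le (by norm_num)).mp hint).norm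
    simp_rw [Complex.norm_cpow_real, Complex.norm_real, Real.norm_eq_abs] at h
    exact h.lintegral_lt_top
  · refine (setLIntegral_mono measurable_const (g := fun _ => (1 : ℝ≥0∞)) fun x hx => ?_).trans_lt ?_
    · refine ENNReal.ofReal_le_one.mpr (Real.rpow_le_one_of_one_le_of_nonpos ?_ hr0)
      by_contra! h
      exact hx ⟨(abs_lt.mp h).1, (abs_lt.mp h).2.le⟩
    · simp

section

variable {Ω ι : Type*} {mΩ : MeasurableSpace Ω} {μ : Measure Ω}

theorem ae_pos_of_sq_le_mul {X Q : Ω → ℝ} {c : ℝ} (hX : Measurable X)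
    (hlaw : μ.map X = gaussianReal 0 1) (hc : 0 < c) (hle : ∀ ω, X ω ^ 2 ≤ c * Q ω) :
    ∀ᵐ ω ∂μ, 0 < Q ω := by
  have h0 : ∀ᵐ ω ∂μ, X ω ≠ 0 := by
    refine ae_of_ae_map hX.aemeasurable (p := fun x => x ≠ 0) ?_
    rw [hlaw]
    have := nullSingletonClass_gaussianReal (μ := 0) (one_ne_zero (α := NNReal))
    rw [ae_iff]
    simp
  filter_upwards [h0] with ω hω
  have h1 : 0 < X ω ^ 2 := by positivity
  exact pos_of_mul_pos_right (h1.trans_le (hle ω)) hc.le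

theorem memLp_inv_of_sq_le_mul [IsProbabilityMeasure μ] [Fintype ι] {X : ι → Ω → ℝ}
    {Q : Ω → ℝ} {c : ι → ℝ} {m : ℕ}
    (hm : m ≠ 0) (hcard : Fintype.card ι = 4 * m) (hX : ∀ i, Measurable (X i))
    (hQ : Measurable Q) (hlaw : ∀ i, μ.map (X i) = gaussianReal 0 1) (hind : iIndepFun X μ)
    (hc : ∀ i, 0 < c i) (hle : ∀ i ω, X i ω ^ 2 ≤ c i * Q ω) :
    MemLp (fun ω => (Q ω)⁻¹) m μ := by
  refine ⟨hQ.inv.aestronglyMeasurable, ?_⟩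
  rw [eLpNorm_lt_top_iff_lintegral_rpow_enorm_lt_top (by exact_mod_cast hm) (by simp)]
  have hne : ∀ i, ∀ᵐ ω ∂μ, X i ω ≠ 0 := fun i => by
    filter_upwards [ae_pos_of_sq_le_mul (Q := fun ω => X i ω ^ 2) (hX i) (hlaw i) one_pos (by simp)]
      with ω hω h
    simp [h] at hω
  -- Each of the `4m` factors bounds `Q^(-1/4)`; the resulting power `-1/2` of `|X i|` lies above
  -- the critical `-1`.
  let g : ι → ℝ → ℝ≥0∞ := fun i x =>
    ENNReal.ofReal (c i ^ (1 / 4 : ℝ)) * ENNReal.ofReal (|x| ^ (-(1 / 2) : ℝ))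
  have hg : ∀ i, Measurable (g i) := fun i => by fun_prop
  have hbound : ∀ᵐ ω ∂μ, ‖(Q ω)⁻¹‖ₑ ^ (m : ℝ≥0∞).toReal ≤ ∏ i, g i (X i ω) := by
    filter_upwards [ae_all_iff.mpr hne] with ω hω
    have hi : Nonempty ι := Fintype.card_pos_iff.mp (by omega)
    have hpos : 0 < Q ω := by
      obtain ⟨i⟩ := hi
      have : 0 < X i ω ^ 2 := by have := hω i; positivity
      exact pos_of_mul_pos_right (this.trans_le (hle i ω)) (hc i).le
    have key : ∀ i, Q ω ^ (-(1 / 4) : ℝ) ≤ c i ^ (1 / 4 : ℝ) * |X i ω| ^ (-(1 / 2) : ℝ) := by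
      intro i
      have hXp : 0 < |X i ω| := abs_pos.mpr (hω i)
      have h1 : (c i * Q ω) ^ (-(1 / 4) : ℝ) ≤ (X i ω ^ 2) ^ (-(1 / 4) : ℝ) :=
        Real.rpow_le_rpow_of_nonpos (by rw [← sq_abs]; positivity) (hle i ω) (by norm_num)
      rw [← sq_abs, ← Real.rpow_natCast, ← Real.rpow_mul hXp.le,
        Real.mul_rpow (hc i).le hpos.le] at h1
      calc Q ω ^ (-(1 / 4) : ℝ)
          = c i ^ (1 / 4 : ℝ) * (c i ^ (-(1 / 4) : ℝ) * Q ω ^ (-(1 / 4) : ℝ)) := by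
            rw [← mul_assoc, ← Real.rpow_add (hc i)]; simp
        _ ≤ _ := by
            refine mul_le_mul_of_nonneg_left (h1.trans_eq ?_) (Real.rpow_nonneg (hc i).le _)
            norm_num
    have hprod : ‖(Q ω)⁻¹‖ₑ ^ (m : ℝ≥0∞).toReal
        = ∏ _i : ι, ENNReal.ofReal (Q ω ^ (-(1 / 4) : ℝ)) := by
      rw [Finset.prod_const, Finset.card_univ, hcard, ENNReal.toReal_natCast, ENNReal.rpow_natCast,
        pow_mul, ← ENNReal.ofReal_pow (by positivity), ← Real.rpow_natCast,
        ← Real.rpow_mul hpos.le, Real.enorm_eq_ofReal (by positivity)]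
      norm_num [Real.rpow_neg_one]
    rw [hprod]
    refine Finset.prod_le_prod' fun i _ => ?_
    change _ ≤ ENNReal.ofReal (c i ^ (1 / 4 : ℝ)) * ENNReal.ofReal _
    rw [← ENNReal.ofReal_mul (Real.rpow_nonneg (hc i).le _)]
    exact ENNReal.ofReal_le_ofReal (key i)
  refine (lintegral_mono_ae hbound).trans_lt ?_
  have := lintegral_prod_eq_prod_lintegral_of_indepFun Finset.univ (fun i => g i ∘ X i)
    (hind.comp g hg) fun i => (hg i).comp (hX i)
  simp only [Function.comp_apply] at this
  rw [this]
  refine ENNReal.prod_lt_top fun i _ => ?_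
  rw [← lintegral_map (hg i) (hX i), hlaw i, lintegral_const_mul _ (by fun_prop)]
  exact ENNReal.mul_lt_top (by simp)
    (lintegral_abs_rpow_gaussianReal_lt_top (by norm_num) (by norm_num))

end

theorem exists_orthonormal_of_not_finiteDimensional {E : Type*} [NormedAddCommGroup E]
    [InnerProductSpace ℝ E] (h : ¬ FiniteDimensional ℝ E) (n : ℕ) :
    ∃ e : Fin n → E, Orthonormal ℝ e := by
  have hn : (n : Cardinal) ≤ Module.rank ℝ E :=
    (Cardinal.natCast_le_aleph0).trans (not_lt.mp (mt Module.rank_lt_aleph0_iff.mp h))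
  obtain ⟨s, rfl, hs⟩ := le_rank_iff_exists_linearIndependent_finset.mp hn
  exact ⟨_, InnerProductSpace.gramSchmidtNormed_orthonormal
    (hs.comp s.equivFin.symm s.equivFin.symm.injective)⟩

/-! ### The induced operator and its trace -/

namespace CameronMartin

variable {W : Type*} [NormedAddCommGroup W] [NormedSpace ℝ W] [CompleteSpace W]
  [SecondCountableTopology W] [MeasurableSpace W] [BorelSpace W] {P : Measure W} [IsGaussian P]

theorem norm_incl_le (h : Space P) :
    ‖incl P h‖ ≤ ‖StrongDual.toLp (𝕜 := ℝ) (E := W) P 2‖ * ‖h‖ := by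
  obtain ⟨f, rfl⟩ := (equiv P).surjective h
  have hf : ‖equiv P f‖ = ‖(f : Lp ℝ 2 P)‖ := by
    rw [← norm_equiv_symm, LinearEquiv.symm_apply_apply, Submodule.coe_norm]
  refine NormedSpace.norm_le_dual_bound ℝ _ (by positivity) fun φ => ?_
  change ‖φ (J P f)‖ ≤ _
  rw [apply_J, hf]
  refine (norm_inner_le_norm _ _).trans ?_
  grw [ContinuousLinearMap.le_opNorm]
  exact (mul_right_comm _ _ _).le

variable (P) in
/-- The inclusion `H → W` as a continuous linear map. -/
noncomputable def inclL : Space P →L[ℝ] W :=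
  (incl P).mkContinuous _ norm_incl_le

theorem existsUnique_isInducedOperator (Φ : W →L[ℝ] W →L[ℝ] ℝ) :
    ∃! T : Space P →L[ℝ] Space P, IsInducedOperator P Φ T := by
  let B : Space P →L[ℝ] Space P →L[ℝ] ℝ := Φ.bilinearComp (inclL P) (inclL P)
  refine ⟨InnerProductSpace.continuousLinearMapOfBilin (𝕜 := ℝ) B, fun h k => ?_, fun T hT => ?_⟩
  · exact (InnerProductSpace.continuousLinearMapOfBilin_apply (𝕜 := ℝ) B h k).symm
  · ext1 h
    exact InnerProductSpace.unique_continuousLinearMapOfBilin (𝕜 := ℝ) B fun k => (hT h k).symm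

theorem integrable_apply_self (Φ : W →L[ℝ] W →L[ℝ] ℝ) : Integrable (fun ω => Φ ω ω) P := by
  have h2 : Integrable (fun ω : W => ‖ω‖ ^ 2) P :=
    (IsGaussian.memLp_id P 2 (by simp)).integrable_norm_pow (by simp)
  refine (h2.const_mul ‖Φ‖).mono' (by fun_prop) (ae_of_all _ fun ω => ?_)
  rw [sq, ← mul_assoc]
  exact Φ.le_opNorm₂ ω ω

/-- Integrate `Φ ≥ 0` at the residual `ω - ∑ gᵢ(ω) hᵢ`, where `hᵢ = J gᵢ`. As `∫ gᵢ(ω) ω dP = hᵢ`,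
the cross terms give `-2 ∑ Φ(hᵢ, hᵢ)`; orthonormality of the `gᵢ` reduces the double sum to `∑ Φ(hᵢ,
hᵢ)`. -/
theorem sum_apply_incl_le_integral {Φ : W →L[ℝ] W →L[ℝ] ℝ} (hsymm : ∀ x y, Φ x y = Φ y x)
    (hnonneg : ∀ x, 0 ≤ Φ x x) {ι : Type*} {b : ι → Space P} (hb : Orthonormal ℝ b)
    (s : Finset ι) : ∑ i ∈ s, Φ (incl P (b i)) (incl P (b i)) ≤ ∫ ω, Φ ω ω ∂P := by
  classical
  let g : ι → Lp ℝ 2 P := fun i => (equiv P).symm (b i)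
  let h : ι → W := fun i => incl P (b i)
  have hgh : ∀ i, ∫ ω, g i ω • ω ∂P = h i := fun i => by
    rw [← incl_equiv, LinearEquiv.apply_symm_apply]
  have hgg : ∀ i j, ∫ ω, g i ω * g j ω ∂P = if i = j then 1 else 0 := fun i j => by
    rw [← orthonormal_iff_ite.mp hb i j]
    have := inner_equiv P ((equiv P).symm (b i)) ((equiv P).symm (b j))
    rw [LinearEquiv.apply_symm_apply, LinearEquiv.apply_symm_apply] at this
    rw [this, L2.inner_def]
    exact integral_congr_ae (ae_of_all _ fun ω => by simp [g, mul_comm])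
  have hgi : ∀ i j, Integrable (fun ω => g i ω * g j ω) P := fun i j =>
    (Lp.memLp (g i)).integrable_mul (Lp.memLp (g j))
  have hlin : ∀ i, ∫ ω, g i ω * Φ (h i) ω ∂P = Φ (h i) (h i) := fun i => by
    conv_rhs => rw [← congrArg (Φ (h i)) (hgh i)]
    rw [← ContinuousLinearMap.integral_comp_comm _ (integrable_smul_id P (g i))]
    simp
  have hlini : ∀ i, Integrable (fun ω => g i ω * Φ (h i) ω) P := fun i => by
    simpa using (Φ (h i)).integrable_comp (integrable_smul_id P (g i))
  have hexp : ∀ ω, Φ (ω - ∑ i ∈ s, g i ω • h i) (ω - ∑ i ∈ s, g i ω • h i)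
      = Φ ω ω - 2 * ∑ i ∈ s, g i ω * Φ (h i) ω
        + ∑ i ∈ s, ∑ j ∈ s, g i ω * g j ω * Φ (h i) (h j) := fun ω => by
    have h1 : Φ ω (∑ i ∈ s, g i ω • h i) = ∑ i ∈ s, g i ω * Φ (h i) ω := by
      simp [hsymm ω]
    have h2 : Φ (∑ i ∈ s, g i ω • h i) (∑ i ∈ s, g i ω • h i)
        = ∑ i ∈ s, ∑ j ∈ s, g i ω * g j ω * Φ (h i) (h j) := by
      simp only [map_sum, map_smul, sum_apply, smul_apply, smul_eq_mul, Finset.mul_sum, mul_assoc]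
      refine Finset.sum_congr rfl fun i _ => Finset.sum_congr rfl fun j _ => ?_
      rw [hsymm (h j)]
    rw [map_sub, map_sub, sub_apply, sub_apply, h2,
      hsymm (∑ i ∈ s, g i ω • h i) ω, h1]
    ring
  have hpos : 0 ≤ ∫ ω, Φ (ω - ∑ i ∈ s, g i ω • h i) (ω - ∑ i ∈ s, g i ω • h i) ∂P :=
    integral_nonneg fun ω => hnonneg _
  have hi1 : Integrable (fun ω => 2 * ∑ i ∈ s, g i ω * Φ (h i) ω) P :=
    (integrable_finsetSum _ fun i _ => hlini i).const_mul 2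
  have hi2 : ∀ i ∈ s, Integrable (fun ω => ∑ j ∈ s, g i ω * g j ω * Φ (h i) (h j)) P :=
    fun i _ => integrable_finsetSum _ fun j _ => (hgi i j).mul_const _
  have hi3 := integrable_apply_self (P := P) Φ
  simp_rw [hexp] at hpos
  rw [integral_add (by exact hi3.sub hi1) (integrable_finsetSum _ hi2), integral_sub hi3 hi1,
    integral_const_mul, integral_finsetSum _ fun i _ => hlini i, integral_finsetSum _ hi2,
    Finset.sum_congr rfl fun i _ => hlin i,
    Finset.sum_congr rfl fun i _ => integral_finsetSum s fun j _ => (hgi i j).mul_const _] at hpos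
  simp_rw [integral_mul_const, hgg] at hpos
  have hdiag : ∑ i ∈ s, ∑ j ∈ s, (if i = j then 1 else 0) * Φ (h i) (h j)
      = ∑ i ∈ s, Φ (h i) (h i) := Finset.sum_congr rfl fun i hi => by simp [hi]
  rw [hdiag] at hpos
  change ∑ i ∈ s, Φ (h i) (h i) ≤ _
  linarith

theorem IsInducedOperator.isPositive {Φ : W →L[ℝ] W →L[ℝ] ℝ} (hsymm : ∀ x y, Φ x y = Φ y x)
    (hnonneg : ∀ x, 0 ≤ Φ x x) {T : Space P →L[ℝ] Space P} (hT : IsInducedOperator P Φ T) :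
    T.IsPositive := by
  rw [ContinuousLinearMap.isPositive_iff]
  refine ⟨fun x y => ?_, fun x => ?_⟩
  · change inner ℝ (T x) y = inner ℝ x (T y)
    rw [real_inner_comm (T y), ← hT, ← hT, hsymm]
  · rw [← hT]
    exact hnonneg _

theorem IsInducedOperator.isTraceClass {Φ : W →L[ℝ] W →L[ℝ] ℝ} (hsymm : ∀ x y, Φ x y = Φ y x)
    (hnonneg : ∀ x, 0 ≤ Φ x x) {T : Space P →L[ℝ] Space P} (hT : IsInducedOperator P Φ T) :
    IsTraceClass T := by
  have hpos := hT.isPositive hsymm hnonneg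
  refine ⟨T, hpos, by rw [hpos.isSelfAdjoint.adjoint_eq], fun ι b => ?_⟩
  simp_rw [← hT (b _) (b _)]
  exact summable_of_sum_le (fun i => hnonneg _)
    (sum_apply_incl_le_integral hsymm hnonneg b.orthonormal)

/-! ### Covariances of the functionals `Φ(h, ·)` -/

theorem toLp_mem_dualClosure {W : Type*} [NormedAddCommGroup W] [NormedSpace ℝ W]
    [MeasurableSpace W] [BorelSpace W] (P : Measure W) (φ : StrongDual ℝ W) :
    StrongDual.toLp P 2 φ ∈ dualClosure P :=
  Submodule.le_topologicalClosure _ ⟨φ, rfl⟩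

/-- Both sides have inner product `Φ(h, J f)` with every `J f`, by `apply_J`. This turns inner
products in the range of `T` into covariances. -/
theorem IsInducedOperator.toLp_apply_incl {Φ : W →L[ℝ] W →L[ℝ] ℝ} {T : Space P →L[ℝ] Space P}
    (hT : IsInducedOperator P Φ T) (h : Space P) :
    equiv P ⟨StrongDual.toLp P 2 (Φ (incl P h)), toLp_mem_dualClosure P _⟩ = T h := by
  refine ext_inner_right ℝ fun k => ?_
  obtain ⟨f, rfl⟩ := (equiv P).surjective k
  rw [inner_equiv, ← hT]
  exact (apply_J P f _).symm

theorem IsInducedOperator.integral_mul_eq_inner {Φ : W →L[ℝ] W →L[ℝ] ℝ}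
    {T : Space P →L[ℝ] Space P} (hT : IsInducedOperator P Φ T) (h k : Space P) :
    ∫ ω, Φ (incl P h) ω * Φ (incl P k) ω ∂P = inner ℝ (T h) (T k) := by
  have h2 : MemLp id 2 P := IsGaussian.memLp_id P 2 (by simp)
  have hae : ∀ φ : StrongDual ℝ W, StrongDual.toLp (𝕜 := ℝ) P 2 φ =ᵐ[P] φ := fun φ => by
    rw [StrongDual.toLp_apply h2]
    exact MemLp.coeFn_toLp (h2.continuousLinearMap_comp φ)
  rw [← hT.toLp_apply_incl h, ← hT.toLp_apply_incl k, inner_equiv, L2.inner_def]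
  refine integral_congr_ae ?_
  filter_upwards [hae (Φ (incl P h)), hae (Φ (incl P k))] with ω h1 h2
  rw [h1, h2]
  simp [mul_comm]

theorem IsInducedOperator.ae_pos_and_memLp_inv {W : Type*} [NormedAddCommGroup W] [NormedSpace ℝ W]
    [CompleteSpace W] [SecondCountableTopology W] [MeasurableSpace W] [BorelSpace W]
    {P : Measure W} [IsGaussian P] (hP : ∀ φ : StrongDual ℝ W, ∫ ω, φ ω ∂P = 0)
    {Φ : W →L[ℝ] W →L[ℝ] ℝ} (hsymm : ∀ x y, Φ x y = Φ y x) (hnonneg : ∀ x, 0 ≤ Φ x x)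
    {T : Space P →L[ℝ] Space P} (hT : IsInducedOperator P Φ T)
    (hrank : ¬ FiniteDimensional ℝ (LinearMap.range T.toLinearMap)) {m : ℕ} (hm : m ≠ 0) :
    (∀ᵐ ω ∂P, 0 < Φ ω ω) ∧ MemLp (fun ω => (Φ ω ω)⁻¹) m P := by
  obtain ⟨e, he⟩ := exists_orthonormal_of_not_finiteDimensional hrank (4 * m)
  choose h hh using fun i => (e i).2
  have he' : ∀ i j, inner ℝ (T (h i)) (T (h j)) = if i = j then (1 : ℝ) else 0 := fun i j => by
    rw [← orthonormal_iff_ite.mp he i j]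
    exact congrArg₂ (inner ℝ) (hh i) (hh j)
  let X : Fin (4 * m) → W → ℝ := fun i => Φ (incl P (h i))
  let c : Fin (4 * m) → ℝ := fun i => Φ (incl P (h i)) (incl P (h i))
  have hle : ∀ i ω, X i ω ^ 2 ≤ c i * Φ ω ω := fun i ω => by
    have := LinearMap.BilinForm.apply_mul_apply_le_of_forall_zero_le Φ.toBilinForm hnonneg
      (incl P (h i)) ω
    simp only [ContinuousLinearMap.toBilinForm_apply] at this
    rwa [hsymm ω, ← sq] at this
  have hX : ∀ i, Measurable (X i) := fun i => (Φ (incl P (h i))).continuous.measurable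
  have hgauss : HasGaussianLaw (fun ω i => X i ω) P :=
    IsGaussian.hasGaussianLaw_id.map (ContinuousLinearMap.pi fun i => Φ (incl P (h i)))
  have hX2 : ∀ i, MemLp (X i) 2 P := fun i => (hgauss.eval i).memLp_two
  have hcov : ∀ i j, cov[X i, X j; P] = if i = j then 1 else 0 := fun i j => by
    rw [covariance_eq_sub (hX2 i) (hX2 j), hP, zero_mul, sub_zero, ← he']
    exact hT.integral_mul_eq_inner _ _
  have hlaw : ∀ i, P.map (X i) = gaussianReal 0 1 := fun i => by
    rw [(hgauss.eval i).map_eq_gaussianReal, hP, ← covariance_self (hX i).aemeasurable, hcov]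
    simp
  have hind : iIndepFun X P :=
    hgauss.iIndepFun_of_covariance_eq_zero fun i j hij => by rw [hcov, if_neg hij]
  -- If `c i = 0`, Cauchy–Schwarz forces `X i` to vanish identically, contradicting variance `1`.
  have hc : ∀ i, 0 < c i := fun i => by
    refine (hnonneg _).lt_of_ne fun h0 => ?_
    have hz : ∀ ω, X i ω = 0 := fun ω => by
      have := hle i ω
      rw [show c i = 0 from h0.symm, zero_mul] at this
      exact pow_eq_zero_iff two_ne_zero |>.mp (this.antisymm (sq_nonneg _))
    have h1 := hT.integral_mul_eq_inner (h i) (h i)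
    rw [he', if_pos rfl] at h1
    simp [show ∀ ω, Φ (incl P (h i)) ω = 0 from hz] at h1
  have hQ : Measurable fun ω => Φ ω ω :=
    (show Continuous fun ω => Φ ω ω by fun_prop).measurable
  have i₀ : Fin (4 * m) := ⟨0, by omega⟩
  exact ⟨ae_pos_of_sq_le_mul (hX i₀) (hlaw i₀) (hc i₀) (hle i₀),
    memLp_inv_of_sq_le_mul hm (Fintype.card_fin _) hX hQ hlaw hind hc hle⟩

end CameronMartin

theorem theorem3p8 {W : Type*} [NormedAddCommGroup W] [NormedSpace ℝ W] [CompleteSpace W]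
    [SecondCountableTopology W] [MeasurableSpace W] [BorelSpace W]
    (P : Measure W) [IsGaussian P] (hP : ∀ φ : StrongDual ℝ W, ∫ ω, φ ω ∂P = 0)
    (Φ : W →L[ℝ] W →L[ℝ] ℝ) (hsymm : ∀ x y : W, Φ x y = Φ y x) (hnonneg : ∀ x : W, 0 ≤ Φ x x) :
    (∃! T : CameronMartin.Space P →L[ℝ] CameronMartin.Space P,
      CameronMartin.IsInducedOperator P Φ T) ∧
    ∀ T : CameronMartin.Space P →L[ℝ] CameronMartin.Space P,
      CameronMartin.IsInducedOperator P Φ T →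
        CameronMartin.IsTraceClass T ∧
        (¬ FiniteDimensional ℝ (LinearMap.range T.toLinearMap) →
          (∀ᵐ ω ∂P, 0 < Φ ω ω) ∧
          ∀ p : ℝ≥0∞, 1 ≤ p → p ≠ ∞ → MemLp (fun ω => (Φ ω ω)⁻¹) p P) := by
  refine ⟨CameronMartin.existsUnique_isInducedOperator Φ, fun T hT =>
    ⟨hT.isTraceClass hsymm hnonneg, fun hrank =>
      ⟨(hT.ae_pos_and_memLp_inv hP hsymm hnonneg hrank one_ne_zero).1, fun p _ hp => ?_⟩⟩⟩
  -- On a probability space, integer exponents suffice.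
  obtain ⟨m, hm⟩ := ENNReal.exists_nat_gt hp
  have hm0 : m ≠ 0 := by
    rintro rfl
    simp at hm
  exact (hT.ae_pos_and_memLp_inv hP hsymm hnonneg hrank hm0).2.mono_exponent hm.le
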